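/- Let $d \ge 2$ be an integer and let $p \in [1,\infty]$. Let $P_d \subset \mathbb{R}^d$ be the set of all $d!$ permutations of the vector $(0,1,\dots,d-1)$, and let $B_{\mathsf{vote}} = \mathrm{conv}(P_d \cup -P_d)$. Let $B_p^d$ be the closed unit ball of the $\ell_p$ norm on $\mathbb{R}^d$, and let $r(p) \ge 0$ be the least radius for which $B_{\mathsf{vote}} \subseteq r(p) B_p^d$; the ball $r(p)B_p^d$ is the minimum enclosing $\ell_p$ ball of $B_{\mathsf{vote}}$. Rejection sampling of $B_{\mathsf{vote}}$ from this ball draws independent samples $X_1, X_2, \dots$, each uniformly distributed (with respect to Lebesgue measure) on $r(p)B_p^d$, and stops at the first $N$ with $X_N \in B_{\mathsf{vote}}$ (with $N=\infty$ if there is none). Then the expected number of samples satisfies $$\mathbb{E}[N] \ \ge\ \frac{(1.77)^{d}}{4} \quad\text{if } d \le p, \qquad\qquad \mathbb{E}[N] \ \ge\ \frac{(1.2)^{d-1}}{d} \quad\text{if } d > p .$$ -/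

import Mathlib

open MeasureTheory ProbabilityTheory
open scoped ENNReal

/-- `P_d`: the vectors of `ℝ^d` that are permutations of `(0, 1, …, d - 1)`. -/
def votePermutations (d : ℕ) : Set (Fin d → ℝ) :=
  Set.range fun (σ : Equiv.Perm (Fin d)) (i : Fin d) => ((σ i : ℕ) : ℝ)

/-- `B_vote = CH(P_d ∪ -P_d)`. The set `-P_d` is written as an image, so that no pointwise
instance has to be opened. -/
def voteBall (d : ℕ) : Set (Fin d → ℝ) :=
  convexHull ℝ (votePermutations d ∪ (fun x => -x) '' votePermutations d)

/-- The origin-centred closed `ℓ_p` ball `r B_p^d` of radius `r` in `ℝ^d`, for `p ∈ [1, ∞]`.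
The norm is the `ℓ_p` norm of Mathlib; the ambient type `Fin d → ℝ` carries Lebesgue measure. -/
def lpBall (d : ℕ) (p : ℝ≥0∞) (r : ℝ) : Set (Fin d → ℝ) :=
  {x | ‖(WithLp.toLp p x : PiLp p fun _ : Fin d => ℝ)‖ ≤ r}

/-- The radius of the minimum `ℓ_p` ball `r B_p^d` that contains the set `B`. -/
noncomputable def minEnclosingRadius {d : ℕ} (p : ℝ≥0∞) (B : Set (Fin d → ℝ)) : ℝ :=
  sInf {r : ℝ | 0 ≤ r ∧ B ⊆ lpBall d p r}

/-- The minimum `ℓ_p` ball that contains the set `B`. -/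
noncomputable def minEnclosingBall {d : ℕ} (p : ℝ≥0∞) (B : Set (Fin d → ℝ)) :
    Set (Fin d → ℝ) :=
  lpBall d p (minEnclosingRadius p B)

/-- The number of samples that rejection sampling of `B` draws from the proposals
`X 0, X 1, X 2, …`: it draws them one after the other and stops at the first one that lies in `B`,
which is counted too. The value is `∞` if no proposal lies in `B`. -/
noncomputable def rejectionSampleCount {Ω E : Type*} (X : ℕ → Ω → E) (B : Set E) (ω : Ω) : ℝ≥0∞ :=
  ⨅ (n : ℕ) (_ : X n ω ∈ B), ((n + 1 : ℕ) : ℝ≥0∞)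

/-- For the vote ball the infimum in `minEnclosingRadius` is a minimum. -/
theorem isLeast_minEnclosingRadius_voteBall (d : ℕ) (p : ℝ≥0∞) (hp : 1 ≤ p) :
    IsLeast {r : ℝ | 0 ≤ r ∧ voteBall d ⊆ lpBall d p r} (minEnclosingRadius p (voteBall d)) := by
  have : Fact (1 ≤ p) := ⟨hp⟩
  have hne : {r : ℝ | 0 ≤ r ∧ voteBall d ⊆ lpBall d p r}.Nonempty := by
    have hfin : (votePermutations d ∪ (fun x => -x) '' votePermutations d).Finite :=
      (Set.finite_range _).union ((Set.finite_range _).image _)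
    have hc : IsCompact (voteBall d) := hfin.isCompact_convexHull ℝ
    have hf : Continuous fun x : Fin d → ℝ =>
        ‖(WithLp.toLp p x : PiLp p fun _ : Fin d => ℝ)‖ :=
      (PiLp.continuous_toLp p _).norm
    obtain ⟨C, hC⟩ := hc.bddAbove_image hf.continuousOn
    exact ⟨max C 0, le_max_right _ _, fun x hx =>
      (hC ⟨x, hx, rfl⟩).trans (le_max_left _ _)⟩
  refine ⟨⟨le_csInf hne fun r hr => hr.1, fun x hx => ?_⟩, fun r hr => ?_⟩
  · exact le_csInf hne fun r hr => hr.2 hx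
  · exact csInf_le ⟨0, fun s hs => hs.1⟩ hr

/-! ### The volume of the vote ball -/

/-! The expected number of samples is at least the ratio of the two volumes
(`le_lintegral_rejectionSampleCount_of_isUniform`), so the vote ball has to be bounded from above
and the enclosing ball from below.

Upper bound, `volume_voteBall_le`: the centred vectors `d a - (∑ a) 1` form a lattice in the
hyperplane of coordinate sum zero, and the projection of the vote ball, a permutohedron, lies in the
Voronoi cell of that lattice. Since coordinate sums on the vote ball are at most `d (d - 1) / 2` in
absolute value, one further generator of coordinate sum `d (d - 1)` yields a full lattice whose
translates of the vote ball have disjoint interiors. The volume is therefore at most the covolume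
`(d - 1) d ^ (d - 1)`.

Lower bound: the vertex `(0, 1, …, d - 1)` bounds the radius, and the volume of an `ℓ_p` ball is
explicit in Gamma values. For `d ≤ p` the last coordinate of that vertex and elementary Gamma bounds
suffice. For `p < d` the whole power sum `∑ k ^ p` is needed, together with a Stirling-type bound on
`Γ(d / p + 1)`. -/

theorem sum_sign_sub_natCast (d : ℕ) (k : ℕ) (hk : k < d) :
    ∑ j : Fin d, Real.sign ((k : ℝ) - (j : ℕ)) = 2 * k - (d - 1) := by
  rw [Fin.sum_univ_eq_sum_range (fun j => Real.sign ((k : ℝ) - (j : ℕ)))]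
  induction d, hk using Nat.le_induction with
  | base =>
    rw [Finset.sum_range_succ, Finset.sum_congr rfl (g := fun _ => (1 : ℝ))]
    · simp; ring
    · intro j hj
      refine Real.sign_of_pos (sub_pos.2 ?_)
      exact_mod_cast Finset.mem_range.1 hj
  | succ n hn ih =>
    rw [Finset.sum_range_succ, ih, Real.sign_of_neg]
    · push_cast; ring
    · refine sub_neg.2 ?_
      exact_mod_cast hn

/-- The vector `d a - (∑ a) 1`, for `a` an integer vector. -/
def centeredVector {d : ℕ} (a : Fin d → ℤ) (i : Fin d) : ℝ := d * a i - ∑ j, (a j : ℝ)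

theorem centeredVector_neg {d : ℕ} (a : Fin d → ℤ) (i : Fin d) :
    centeredVector (-a) i = -centeredVector a i := by
  simp [centeredVector]; ring

theorem sum_centeredVector {d : ℕ} (a : Fin d → ℤ) : ∑ i, centeredVector a i = 0 := by
  simp [centeredVector, Finset.sum_sub_distrib, ← Finset.mul_sum]

/-- A rank is a sum of signs: `2 σ i - (d - 1) = ∑ j, sign (σ i - σ j)`. The constant `d - 1` drops
out against a vector of coordinate sum zero, and antisymmetry of the sign turns the remaining
coefficients into differences. -/
theorem sum_mul_centeredVector {d : ℕ} (a : Fin d → ℤ) (σ : Equiv.Perm (Fin d)) :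
    ∑ i, ((σ i : ℕ) : ℝ) * centeredVector a i =
      d / 4 * ∑ i, ∑ j, ((a i : ℝ) - a j) * Real.sign (((σ i : ℕ) : ℝ) - (σ j : ℕ)) := by
  have hs (i : Fin d) : ∑ j, Real.sign (((σ i : ℕ) : ℝ) - (σ j : ℕ)) =
      2 * ((σ i : ℕ) : ℝ) - (d - 1) := by
    rw [← sum_sign_sub_natCast d (σ i) (σ i).2]
    exact Equiv.sum_comp σ fun j => Real.sign (((σ i : ℕ) : ℝ) - (j : ℕ))
  set s : Fin d → Fin d → ℝ := fun i j => Real.sign (((σ i : ℕ) : ℝ) - (σ j : ℕ)) with hsdef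
  have hanti (i j : Fin d) : s j i = -s i j := by
    simp only [hsdef]
    rw [← Real.sign_neg, neg_sub]
  have h1 : ∑ i, ((σ i : ℕ) : ℝ) * centeredVector a i =
      1 / 2 * ∑ i, ∑ j, centeredVector a i * s i j := by
    have : ∀ i, ∑ j, centeredVector a i * s i j =
        2 * (((σ i : ℕ) : ℝ) * centeredVector a i) - (d - 1) * centeredVector a i := by
      intro i
      rw [← Finset.mul_sum, hs]; ring
    simp_rw [this]
    rw [Finset.sum_sub_distrib, ← Finset.mul_sum, ← Finset.mul_sum, sum_centeredVector]
    ring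
  have h2 : ∑ i, ∑ j, centeredVector a i * s i j = -∑ i, ∑ j, centeredVector a j * s i j := by
    rw [Finset.sum_comm, ← Finset.sum_neg_distrib]
    refine Finset.sum_congr rfl fun i _ => ?_
    rw [← Finset.sum_neg_distrib]
    refine Finset.sum_congr rfl fun j _ => ?_
    rw [hanti]; ring
  have h3 : ∑ i, ∑ j, centeredVector a i * s i j - ∑ i, ∑ j, centeredVector a j * s i j =
      d * ∑ i, ∑ j, ((a i : ℝ) - a j) * s i j := by
    rw [← Finset.sum_sub_distrib, Finset.mul_sum]
    refine Finset.sum_congr rfl fun i _ => ?_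
    rw [← Finset.sum_sub_distrib, Finset.mul_sum]
    refine Finset.sum_congr rfl fun j _ => ?_
    simp only [centeredVector]; ring
  rw [h1]
  linarith

theorem sum_centeredVector_sq {d : ℕ} (a : Fin d → ℤ) :
    ∑ i, centeredVector a i ^ 2 = d / 2 * ∑ i, ∑ j, ((a i : ℝ) - a j) ^ 2 := by
  have h1 : ∑ i, centeredVector a i ^ 2 =
      d ^ 2 * ∑ i, (a i : ℝ) ^ 2 - d * (∑ j, (a j : ℝ)) ^ 2 := by
    have : ∀ i, centeredVector a i ^ 2 = d ^ 2 * (a i : ℝ) ^ 2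
        - 2 * d * (∑ j, (a j : ℝ)) * a i + (∑ j, (a j : ℝ)) ^ 2 := by
      intro i; simp only [centeredVector]; ring
    simp_rw [this]
    rw [Finset.sum_add_distrib, Finset.sum_sub_distrib, ← Finset.mul_sum, ← Finset.mul_sum]
    simp
    ring
  have h2 : ∑ i, ∑ j, ((a i : ℝ) - a j) ^ 2 =
      2 * d * ∑ i, (a i : ℝ) ^ 2 - 2 * (∑ j, (a j : ℝ)) ^ 2 := by
    simp only [sub_sq, Finset.sum_add_distrib, Finset.sum_sub_distrib]
    simp [← Finset.mul_sum, ← Finset.sum_mul]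
    ring
  rw [h1, h2]; ring

/-- The Voronoi inequality at a vertex. Both sides are sums over pairs, and it holds pair by pair
because `|z| ≤ z ^ 2` for every integer `z`. -/
theorem sum_perm_mul_centeredVector_le {d : ℕ} (a : Fin d → ℤ) (σ : Equiv.Perm (Fin d)) :
    ∑ i, ((σ i : ℕ) : ℝ) * centeredVector a i ≤ (∑ i, centeredVector a i ^ 2) / 2 := by
  rw [sum_mul_centeredVector, sum_centeredVector_sq]
  have : ∑ i, ∑ j, ((a i : ℝ) - a j) * Real.sign (((σ i : ℕ) : ℝ) - (σ j : ℕ)) ≤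
      ∑ i, ∑ j, ((a i : ℝ) - a j) ^ 2 := by
    refine Finset.sum_le_sum fun i _ => Finset.sum_le_sum fun j _ => ?_
    have h : ∀ z : ℤ, |(z : ℝ)| ≤ (z : ℝ) ^ 2 := by
      intro z
      have := Int.natAbs_le_self_sq z
      rw [Int.natCast_natAbs] at this
      exact_mod_cast this
    have h' := h (a i - a j)
    push_cast at h'
    refine le_trans ?_ h'
    obtain hr | hr | hr := Real.sign_apply_eq (((σ i : ℕ) : ℝ) - (σ j : ℕ)) <;> rw [hr]
    · linarith [neg_abs_le ((a i : ℝ) - a j)]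
    · simp
    · linarith [le_abs_self ((a i : ℝ) - a j)]
  nlinarith [(Nat.cast_nonneg d : (0 : ℝ) ≤ d)]

/-- A linear inequality that holds on the vertices `± σ` holds on the vote ball. -/
theorem voteBall_sum_mul_le {d : ℕ} (w : Fin d → ℝ) (C : ℝ)
    (h : ∀ σ : Equiv.Perm (Fin d), |∑ i, ((σ i : ℕ) : ℝ) * w i| ≤ C)
    {x : Fin d → ℝ} (hx : x ∈ voteBall d) : ∑ i, x i * w i ≤ C := by
  have hconv : Convex ℝ {x : Fin d → ℝ | ∑ i, x i * w i ≤ C} := by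
    have := (convex_Iic (𝕜 := ℝ) C).linear_preimage (Fintype.linearCombination ℝ w)
    simpa [Set.preimage, Fintype.linearCombination_apply] using this
  refine convexHull_min ?_ hconv hx
  rintro _ (⟨σ, rfl⟩ | ⟨_, ⟨σ, rfl⟩, rfl⟩)
  · exact (le_abs_self _).trans (h σ)
  · have := (neg_le_abs _).trans (h σ)
    simpa [Finset.sum_neg_distrib] using this

theorem neg_mem_voteBall {d : ℕ} {x : Fin d → ℝ} (hx : x ∈ voteBall d) : -x ∈ voteBall d := by
  have : -(voteBall d) = voteBall d := by
    unfold voteBall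
    rw [← convexHull_neg]
    congr 1
    ext y
    simp only [Set.mem_neg, Set.mem_union, Set.mem_image]
    constructor
    · rintro (h | ⟨z, h, hz⟩)
      · exact Or.inr ⟨_, h, neg_neg y⟩
      · exact Or.inl (by rwa [← neg_injective hz])
    · rintro (h | ⟨z, h, rfl⟩)
      · exact Or.inr ⟨_, h, rfl⟩
      · exact Or.inl (by rwa [neg_neg])
  rw [← this, Set.mem_neg, neg_neg]; exact hx

theorem sum_mul_centeredVector_le {d : ℕ} (a : Fin d → ℤ) {x : Fin d → ℝ}
    (hx : x ∈ voteBall d) :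
    ∑ i, x i * centeredVector a i ≤ (∑ i, centeredVector a i ^ 2) / 2 := by
  refine voteBall_sum_mul_le _ _ (fun σ => abs_le.2 ⟨?_, sum_perm_mul_centeredVector_le a σ⟩) hx
  have := sum_perm_mul_centeredVector_le (-a) σ
  simp only [centeredVector_neg, mul_neg, neg_sq, Finset.sum_neg_distrib] at this
  linarith

theorem sum_le_of_mem_voteBall {d : ℕ} {x : Fin d → ℝ} (hx : x ∈ voteBall d) :
    ∑ i, x i ≤ d * (d - 1) / 2 := by
  have h := voteBall_sum_mul_le (fun _ => 1) (d * (d - 1) / 2 : ℝ) (fun σ => ?_) hx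
  · simpa using h
  · have h1 : ∑ i, ((σ i : ℕ) : ℝ) = d * (d - 1) / 2 := by
      rw [Equiv.sum_comp σ fun i => ((i : ℕ) : ℝ),
        Fin.sum_univ_eq_sum_range (fun i => (i : ℝ)) d]
      clear hx x σ
      induction d with
      | zero => simp
      | succ n ih => rw [Finset.sum_range_succ, ih]; push_cast; ring
    simp only [mul_one]
    rw [h1, abs_of_nonneg]
    rw [← h1]; positivity

/-- The rows are `d (d - 1) e_k` for `k = i₀` and `d e_k - 1` for the other `k`. -/
noncomputable def packingMatrix (d : ℕ) (i₀ : Fin d) : Matrix (Fin d) (Fin d) ℝ :=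
  Matrix.diagonal (fun i => if i = i₀ then (d * (d - 1) : ℝ) else d) *
    (1 + Matrix.replicateCol Unit (fun i => if i = i₀ then (0 : ℝ) else -1 / d) *
      Matrix.replicateRow Unit fun _ => (1 : ℝ))

theorem packingMatrix_apply (d : ℕ) (i₀ i j : Fin d) :
    packingMatrix d i₀ i j = (if i = i₀ then (d * (d - 1) : ℝ) else d) *
      ((if i = j then 1 else 0) + if i = i₀ then (0 : ℝ) else -1 / d) := by
  rw [packingMatrix, Matrix.diagonal_mul, Matrix.add_apply, Matrix.one_apply, Matrix.mul_apply]
  simp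

/-- The second factor is a rank-one perturbation of the identity, with determinant `1 - (d - 1) / d
= 1 / d`. -/
theorem det_packingMatrix (d : ℕ) (i₀ : Fin d) :
    (packingMatrix d i₀).det = (d - 1) * d ^ (d - 1) := by
  have hd : (d : ℝ) ≠ 0 := by
    have := i₀.pos
    positivity
  rw [packingMatrix, Matrix.det_mul, Matrix.det_diagonal,
    Matrix.det_one_add_replicateCol_mul_replicateRow]
  have h1 : ∏ i, (if i = i₀ then (d * (d - 1) : ℝ) else d) = d * (d - 1) * d ^ (d - 1) := by
    rw [← Finset.mul_prod_erase _ _ (Finset.mem_univ i₀), if_pos rfl,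
      Finset.prod_congr rfl (g := fun _ => (d : ℝ))]
    · simp
    · intro i hi
      rw [if_neg (Finset.ne_of_mem_erase hi)]
  have h2 : (fun _ : Fin d => (1 : ℝ)) ⬝ᵥ (fun i => if i = i₀ then (0 : ℝ) else -1 / d) =
      -((d - 1) / d) := by
    simp only [dotProduct, one_mul]
    rw [← Finset.add_sum_erase _ _ (Finset.mem_univ i₀), if_pos rfl,
      Finset.sum_congr rfl (g := fun _ => (-1 / d : ℝ))]
    · have := i₀.pos
      simp [Nat.cast_sub (show 1 ≤ d from i₀.pos)]
      ring
    · intro i hi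
      rw [if_neg (Finset.ne_of_mem_erase hi)]
  rw [h1, h2]
  field_simp
  ring

/-- An integer combination of the rows whose coordinate sum is less than `d (d - 1)` in absolute
value is a centered vector. -/
theorem exists_eq_centeredVector {d : ℕ} (i₀ : Fin d) (c : Fin d → ℤ) {v : Fin d → ℝ}
    (hv : ∀ j, v j = ∑ i, (c i : ℝ) * packingMatrix d i₀ i j)
    (hsum : |∑ j, v j| < d * (d - 1)) : ∃ a : Fin d → ℤ, v = centeredVector a := by
  have hd : (d : ℝ) ≠ 0 := by
    have := i₀.pos
    positivity
  have hrow : ∀ i, ∑ j, packingMatrix d i₀ i j = if i = i₀ then (d * (d - 1) : ℝ) else 0 := by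
    intro i
    simp only [packingMatrix_apply, ← Finset.mul_sum, Finset.sum_add_distrib]
    by_cases h : i = i₀ <;> simp [h]
    field_simp; norm_num
  have hs : ∑ j, v j = c i₀ * (d * (d - 1)) := by
    simp_rw [hv]
    rw [Finset.sum_comm]
    simp_rw [← Finset.mul_sum, hrow]
    simp
  -- Only row `i₀` has a nonzero coordinate sum, so the bound on the sum of `v` forces this integer
  -- coefficient to vanish.
  have hc : c i₀ = 0 := by
    rw [hs, abs_mul] at hsum
    have hpos : (0 : ℝ) < d * (d - 1) := by
      refine lt_of_le_of_lt ?_ hsum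
      positivity
    rw [abs_of_pos hpos] at hsum
    have h1 : |(c i₀ : ℝ)| < 1 := by
      by_contra! h
      nlinarith
    rw [← Int.cast_abs] at h1
    exact Int.abs_lt_one_iff.1 (by exact_mod_cast h1)
  refine ⟨c, funext fun j => ?_⟩
  have hterm : ∀ i, (c i : ℝ) * packingMatrix d i₀ i j =
      (if i = j then d * (c i : ℝ) else 0) - c i := by
    intro i
    rw [packingMatrix_apply]
    by_cases h : i = i₀
    · subst h; simp [hc]
    · rw [if_neg h, if_neg h]
      by_cases h' : i = j
      · rw [if_pos h', if_pos h']
        field_simp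
        ring
      · rw [if_neg h', if_neg h']
        field_simp
        ring
  rw [hv, Finset.sum_congr rfl fun i _ => hterm i, Finset.sum_sub_distrib]
  simp [centeredVector]

theorem measurableSet_voteBall (d : ℕ) : MeasurableSet (voteBall d) := by
  have hfin : (votePermutations d ∪ (fun x => -x) '' votePermutations d).Finite :=
    (Set.finite_range _).union ((Set.finite_range _).image _)
  exact (hfin.isCompact_convexHull ℝ).isClosed.measurableSet

-- If two translates by distinct lattice vectors met, their difference `v = t (y - x)` would be
-- centred, and the Voronoi inequality at `y` and at `-x` would give `|v| ^ 2 ≤ t |v| ^ 2`, hence `v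
-- = 0`. The factor `t < 1` excludes contact along boundaries.
open scoped Pointwise in
theorem volume_smul_voteBall_le {d : ℕ} (hd : 2 ≤ d) {t : ℝ} (ht0 : 0 < t) (ht1 : t < 1) :
    volume (t • voteBall d) ≤ ENNReal.ofReal ((d - 1) * d ^ (d - 1)) := by
  let i₀ : Fin d := ⟨0, by omega⟩
  have hd' : (2 : ℝ) ≤ d := by exact_mod_cast hd
  have hpos : (0 : ℝ) < (d - 1) * d ^ (d - 1) :=
    mul_pos (by linarith) (pow_pos (by linarith) _)
  have hdet := det_packingMatrix d i₀
  have hli : LinearIndependent ℝ (fun i => packingMatrix d i₀ i) :=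
    Matrix.linearIndependent_rows_of_det_ne_zero (hdet ▸ hpos.ne')
  have : Nonempty (Fin d) := ⟨i₀⟩
  let b := basisOfLinearIndependentOfCardEqFinrank hli (by simp)
  have hb : ⇑b = fun i => packingMatrix d i₀ i := by simp [b]
  have hvol : volume (ZSpan.fundamentalDomain b) = ENNReal.ofReal ((d - 1) * d ^ (d - 1)) := by
    rw [ZSpan.volume_fundamentalDomain, hb]
    rw [show Matrix.of (fun i => packingMatrix d i₀ i) = packingMatrix d i₀ from rfl, hdet,
      abs_of_pos hpos]
  rw [← hvol]
  by_contra! hlt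
  have : Countable (Submodule.span ℤ (Set.range b)).toAddSubgroup :=
    inferInstanceAs (Countable (Submodule.span ℤ (Set.range b)))
  -- Blichfeldt's principle: a set of volume above the covolume has two overlapping translates.
  obtain ⟨l, m, hlm, hdisj⟩ := exists_pair_mem_lattice_not_disjoint_vadd
    (ZSpan.isAddFundamentalDomain' b volume)
    ((measurableSet_voteBall d).const_smul_of_ne_zero ht0.ne').nullMeasurableSet hlt
  obtain ⟨z, ⟨_, ⟨x, hx, rfl⟩, hxz⟩, ⟨_, ⟨y, hy, rfl⟩, hyz⟩⟩ := Set.not_disjoint_iff.1 hdisj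
  have hv : ((l - m : (Submodule.span ℤ (Set.range b)).toAddSubgroup) : Fin d → ℝ) = t • y - t • x := by
    have h1 : (l : Fin d → ℝ) + t • x = z := hxz
    have h2 : (m : Fin d → ℝ) + t • y = z := hyz
    rw [AddSubgroupClass.coe_sub, sub_eq_sub_iff_add_eq_add, h1, add_comm, h2]
  obtain ⟨c, hc⟩ := (Submodule.mem_span_range_iff_exists_fun ℤ).1 (l - m).2
  set v : Fin d → ℝ := ((l - m : (Submodule.span ℤ (Set.range b)).toAddSubgroup) : Fin d → ℝ) with hvdef
  have hvj : ∀ j, v j = ∑ i, (c i : ℝ) * packingMatrix d i₀ i j := by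
    intro j
    rw [← hc, hb]
    simp [Finset.sum_apply]
  have hvxy : ∀ j, v j = t * y j - t * x j := fun j => by rw [hv]; simp
  have hnx := neg_mem_voteBall hx
  have hny := neg_mem_voteBall hy
  have hsum : |∑ j, v j| < d * (d - 1) := by
    have e : ∑ j, v j = t * (∑ j, y j - ∑ j, x j) := by
      simp_rw [hvxy]
      rw [Finset.sum_sub_distrib, ← Finset.mul_sum, ← Finset.mul_sum]; ring
    have h1 := sum_le_of_mem_voteBall hx
    have h2 := sum_le_of_mem_voteBall hy
    have h3 := sum_le_of_mem_voteBall hnx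
    have h4 := sum_le_of_mem_voteBall hny
    simp only [Pi.neg_apply, Finset.sum_neg_distrib] at h3 h4
    have h5 : |∑ j, y j - ∑ j, x j| ≤ d * (d - 1) := abs_le.2 ⟨by linarith, by linarith⟩
    have h6 : (0 : ℝ) < d * (d - 1) := by nlinarith
    rw [e, abs_mul, abs_of_pos ht0]
    nlinarith
  obtain ⟨a, ha⟩ := exists_eq_centeredVector i₀ c hvj hsum
  have hsq : ∑ i, v i ^ 2 ≤ t * ∑ i, v i ^ 2 := by
    have h1 := sum_mul_centeredVector_le a hy
    have h2 := sum_mul_centeredVector_le a hnx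
    rw [← ha] at h1 h2
    calc ∑ i, v i ^ 2 = t * (∑ i, y i * v i + ∑ i, (-x) i * v i) := by
          rw [← Finset.sum_add_distrib, Finset.mul_sum]
          refine Finset.sum_congr rfl fun i _ => ?_
          have := hvxy i
          simp only [Pi.neg_apply]
          calc v i ^ 2 = v i * v i := sq _
            _ = (t * y i - t * x i) * v i := by rw [← this]
            _ = _ := by ring
      _ ≤ t * ∑ i, v i ^ 2 := by
          refine mul_le_mul_of_nonneg_left ?_ ht0.le
          linarith
  have h0 : ∑ i, v i ^ 2 = 0 := by
    have : 0 ≤ ∑ i, v i ^ 2 := Finset.sum_nonneg fun i _ => sq_nonneg _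
    nlinarith
  have hv0 : v = 0 := by
    funext i
    have := (Finset.sum_eq_zero_iff_of_nonneg fun i _ => sq_nonneg (v i)).1 h0 i (Finset.mem_univ i)
    simpa using this
  exact hlm (sub_eq_zero.1 (Subtype.ext hv0))

theorem volume_voteBall_le {d : ℕ} (hd : 2 ≤ d) :
    volume (voteBall d) ≤ ENNReal.ofReal ((d - 1) * d ^ (d - 1)) := by
  have hlim : Filter.Tendsto (fun t : ℝ => ENNReal.ofReal (t ^ d) * volume (voteBall d))
      (nhdsWithin 1 (Set.Iio 1)) (nhds (ENNReal.ofReal (1 ^ d) * volume (voteBall d))) := by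
    refine ENNReal.Tendsto.mul_const ?_ (Or.inl (by simp))
    refine ENNReal.tendsto_ofReal (Filter.Tendsto.mono_left ?_ nhdsWithin_le_nhds)
    exact (continuous_pow d).tendsto 1
  rw [one_pow, ENNReal.ofReal_one, one_mul] at hlim
  refine le_of_tendsto hlim ?_
  filter_upwards [Ioo_mem_nhdsLT (show (0 : ℝ) < 1 by norm_num)] with t ht
  have := volume_smul_voteBall_le hd ht.1 ht.2
  rwa [Measure.addHaar_smul, Module.finrank_fin_fun, abs_of_pos (pow_pos ht.1 _)] at this

/-! ### The expected number of samples -/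

section RejectionSampling

variable {Ω E : Type*}

theorem one_le_rejectionSampleCount (X : ℕ → Ω → E) (B : Set E) (ω : Ω) :
    1 ≤ rejectionSampleCount X B ω :=
  le_iInf₂ fun n _ => by exact_mod_cast Nat.succ_le_succ (Nat.zero_le n)

/-- The number of samples is at least the number of `n` such that the first `n` samples are all
rejected. -/
theorem tsum_indicator_le_rejectionSampleCount (X : ℕ → Ω → E) (B : Set E) (ω : Ω) :
    ∑' n : ℕ, (⋂ k ∈ Finset.range n, X k ⁻¹' Bᶜ).indicator (fun _ => (1 : ℝ≥0∞)) ω ≤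
      rejectionSampleCount X B ω := by
  refine le_iInf₂ fun n hn => ?_
  -- If sample `n` is accepted, only the terms `0, …, n` can be nonzero; term `0` is an empty
  -- intersection.
  rw [tsum_eq_sum (s := Finset.range (n + 1))]
  · calc _ ≤ ∑ _m ∈ Finset.range (n + 1), (1 : ℝ≥0∞) :=
          Finset.sum_le_sum fun m _ => Set.indicator_le_self' (fun _ _ => zero_le) ω
      _ = _ := by simp
  · intro m hm
    refine Set.indicator_of_notMem (fun h => ?_) _
    rw [Finset.mem_range, not_lt] at hm
    exact (Set.mem_iInter₂.1 h n (Finset.mem_range.2 hm)) hn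

variable [MeasurableSpace Ω]

theorem one_le_lintegral_rejectionSampleCount (μ : Measure Ω) [IsProbabilityMeasure μ]
    (X : ℕ → Ω → E) (B : Set E) : 1 ≤ ∫⁻ ω, rejectionSampleCount X B ω ∂μ := by
  calc (1 : ℝ≥0∞) = ∫⁻ _, 1 ∂μ := by simp
    _ ≤ _ := lintegral_mono fun ω => one_le_rejectionSampleCount X B ω

variable [MeasurableSpace E]

/-- The expected number of samples is at least the inverse of the acceptance probability. -/
theorem inv_le_lintegral_rejectionSampleCount {μ : Measure Ω} [IsProbabilityMeasure μ]
    {X : ℕ → Ω → E} {B : Set E} (hB : MeasurableSet B) (hX : ∀ n, AEMeasurable (X n) μ)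
    (hindep : iIndepFun X μ) {q : ℝ≥0∞} (hq : ∀ n, μ (X n ⁻¹' B) ≤ q) :
    q⁻¹ ≤ ∫⁻ ω, rejectionSampleCount X B ω ∂μ := by
  have hnull : ∀ n, NullMeasurableSet (⋂ k ∈ Finset.range n, X k ⁻¹' Bᶜ) μ := fun n =>
    .biInter (Finset.range n).countable_toSet fun k _ =>
      (hX k).nullMeasurableSet_preimage hB.compl
  have hcompl : ∀ k, 1 - q ≤ μ (X k ⁻¹' Bᶜ) := fun k => by
    rw [Set.preimage_compl, prob_compl_eq_one_sub₀ ((hX k).nullMeasurableSet_preimage hB)]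
    exact tsub_le_tsub_left (hq k) 1
  -- Subtraction is truncated and `q` may exceed `1`, so only `1 - (1 - q) ≤ q` is available.
  calc q⁻¹ ≤ (1 - (1 - q))⁻¹ := ENNReal.inv_le_inv.2 (by
        rw [tsub_le_iff_left]
        exact le_tsub_add)
    _ = ∑' n : ℕ, (1 - q) ^ n := (ENNReal.tsum_geometric _).symm
    _ ≤ ∑' n : ℕ, μ (⋂ k ∈ Finset.range n, X k ⁻¹' Bᶜ) := by
        refine ENNReal.tsum_le_tsum fun n => ?_
        rw [hindep.measure_inter_preimage_eq_mul (Finset.range n) fun _ _ => hB.compl]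
        simpa using Finset.prod_le_prod' fun k (_ : k ∈ Finset.range n) => hcompl k
    _ = ∑' n : ℕ, ∫⁻ ω, (⋂ k ∈ Finset.range n, X k ⁻¹' Bᶜ).indicator (fun _ => 1) ω ∂μ := by
        refine tsum_congr fun n => ?_
        rw [lintegral_indicator_const₀ (hnull n), one_mul]
    _ = ∫⁻ ω, ∑' n : ℕ, (⋂ k ∈ Finset.range n, X k ⁻¹' Bᶜ).indicator (fun _ => 1) ω ∂μ :=
        (lintegral_tsum fun n => aemeasurable_const.indicator₀ (hnull n)).symm
    _ ≤ _ := lintegral_mono fun ω => tsum_indicator_le_rejectionSampleCount X B ω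

/-- The expected number of samples is at least `K` if the set from which the proposals are drawn
has `K` times the volume of the target. -/
theorem le_lintegral_rejectionSampleCount_of_isUniform {μ : Measure Ω} [IsProbabilityMeasure μ]
    {X : ℕ → Ω → E} {B S : Set E} {ν : Measure E} (hB : MeasurableSet B) (hS : MeasurableSet S)
    (hS0 : ν S ≠ 0) (hS1 : ν S ≠ ∞) (hunif : ∀ n, pdf.IsUniform (X n) S μ ν)
    (hindep : iIndepFun X μ) {K : ℝ≥0∞} (hK : K * ν B ≤ ν S) :
    K ≤ ∫⁻ ω, rejectionSampleCount X B ω ∂μ := by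
  have hX : ∀ n, AEMeasurable (X n) μ := fun n => (hunif n).aemeasurable hS0 hS1
  refine le_trans ?_ (inv_le_lintegral_rejectionSampleCount (q := (ν S)⁻¹ * ν B) hB hX hindep ?_)
  · rw [ENNReal.le_inv_iff_mul_le]
    calc K * ((ν S)⁻¹ * ν B) = (ν S)⁻¹ * (K * ν B) := by ring
      _ ≤ (ν S)⁻¹ * ν S := by gcongr
      _ = 1 := ENNReal.inv_mul_cancel hS0 hS1
  · intro n
    rw [← Measure.map_apply_of_aemeasurable (hX n) hB, hunif n, cond_apply hS]
    gcongr
    exact Set.inter_subset_right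

end RejectionSampling

/-! ### The volume of the enclosing ball -/

theorem measurableSet_lpBall (d : ℕ) (p : ℝ≥0∞) (hp : 1 ≤ p) (r : ℝ) :
    MeasurableSet (lpBall d p r) := by
  have : Fact (1 ≤ p) := ⟨hp⟩
  have hf : Continuous fun x : Fin d → ℝ =>
      ‖(WithLp.toLp p x : PiLp p fun _ : Fin d => ℝ)‖ :=
    (PiLp.continuous_toLp p _).norm
  exact (isClosed_le hf continuous_const).measurableSet

theorem volume_lpBall_top (d : ℕ) {r : ℝ} (hr : 0 ≤ r) :
    volume (lpBall d ∞ r) = ENNReal.ofReal ((2 * r) ^ d) := by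
  have : lpBall d ∞ r = Metric.closedBall 0 r := by
    ext x
    simp [lpBall, PiLp.norm_toLp]
  rw [this, Real.volume_pi_closedBall _ hr]
  simp

theorem volume_lpBall (d : ℕ) (hd : d ≠ 0) {p : ℝ} (hp : 1 ≤ p) {r : ℝ} (hr : 0 ≤ r) :
    volume (lpBall d (ENNReal.ofReal p) r) =
      ENNReal.ofReal (r ^ d * ((2 * Real.Gamma (1 / p + 1)) ^ d / Real.Gamma (d / p + 1))) := by
  have : Nonempty (Fin d) := ⟨⟨0, by omega⟩⟩
  have h : lpBall d (ENNReal.ofReal p) r = {x | (∑ i, |x i| ^ p) ^ (1 / p) ≤ r} := by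
    ext x
    have hp0 : 0 ≤ p := by linarith
    rw [lpBall, Set.mem_ofPred_eq, PiLp.norm_eq_sum (by rw [ENNReal.toReal_ofReal hp0]; linarith),
      ENNReal.toReal_ofReal hp0]
    rfl
  rw [h, volume_sum_rpow_le (Fin d) hp, Fintype.card_fin, ENNReal.ofReal_mul (pow_nonneg hr d),
    ENNReal.ofReal_pow hr]

theorem natCast_mem_voteBall (d : ℕ) : (fun i : Fin d => ((i : ℕ) : ℝ)) ∈ voteBall d :=
  subset_convexHull ℝ _ (Or.inl ⟨1, rfl⟩)

theorem norm_le_minEnclosingRadius (d : ℕ) (p : ℝ≥0∞) (hp : 1 ≤ p) :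
    ‖(WithLp.toLp p fun i : Fin d => ((i : ℕ) : ℝ) : PiLp p fun _ : Fin d => ℝ)‖ ≤
      minEnclosingRadius p (voteBall d) :=
  (isLeast_minEnclosingRadius_voteBall d p hp).1.2 (natCast_mem_voteBall d)

theorem sub_one_le_minEnclosingRadius {d : ℕ} (hd : 1 ≤ d) (p : ℝ≥0∞) (hp : 1 ≤ p) :
    (d : ℝ) - 1 ≤ minEnclosingRadius p (voteBall d) := by
  have : Fact (1 ≤ p) := ⟨hp⟩
  refine le_trans ?_ (norm_le_minEnclosingRadius d p hp)
  have h := PiLp.norm_apply_le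
    (WithLp.toLp p fun i : Fin d => ((i : ℕ) : ℝ) : PiLp p fun _ : Fin d => ℝ) ⟨d - 1, by omega⟩
  rw [PiLp.toLp_apply, Nat.cast_sub hd, Nat.cast_one] at h
  exact (le_abs_self _).trans h

theorem sum_rpow_le_minEnclosingRadius_rpow (d : ℕ) {p : ℝ} (hp : 1 ≤ p) :
    ∑ k ∈ Finset.range d, (k : ℝ) ^ p ≤
      minEnclosingRadius (ENNReal.ofReal p) (voteBall d) ^ p := by
  have hp0 : 0 < p := by linarith
  have h := norm_le_minEnclosingRadius d (ENNReal.ofReal p) (by simpa using hp)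
  rw [PiLp.norm_eq_sum (by rw [ENNReal.toReal_ofReal hp0.le]; linarith),
    ENNReal.toReal_ofReal hp0.le] at h
  simp only [Real.norm_natCast] at h
  rw [Fin.sum_univ_eq_sum_range (fun i => (i : ℝ) ^ p)] at h
  have h0 : 0 ≤ ∑ k ∈ Finset.range d, (k : ℝ) ^ p :=
    Finset.sum_nonneg fun k _ => Real.rpow_nonneg (Nat.cast_nonneg k) p
  have h1 := Real.rpow_le_rpow (Real.rpow_nonneg h0 _) h hp0.le
  rwa [← Real.rpow_mul h0, one_div_mul_cancel hp0.ne', Real.rpow_one] at h1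

/-! ### Bounds on the Gamma function -/

theorem Gamma_add_one_le_one {s : ℝ} (h0 : 0 ≤ s) (h1 : s ≤ 1) : Real.Gamma (s + 1) ≤ 1 := by
  have h := Real.convexOn_Gamma.2 (show (1 : ℝ) ∈ Set.Ioi 0 by simp)
    (show (2 : ℝ) ∈ Set.Ioi 0 by simp) (sub_nonneg.2 h1) h0 (by ring)
  simp only [smul_eq_mul, Real.Gamma_one, Real.Gamma_two] at h
  calc Real.Gamma (s + 1) = Real.Gamma ((1 - s) * 1 + s * 2) := by ring_nf
    _ ≤ _ := h
    _ = 1 := by ring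

theorem inv_add_one_le_Gamma_add_one {s : ℝ} (h0 : 0 ≤ s) :
    (s + 1)⁻¹ ≤ Real.Gamma (s + 1) := by
  have h := Real.Gamma_strictMonoOn_Ici.monotoneOn (show (2 : ℝ) ∈ Set.Ici 2 by simp)
    (show s + 1 + 1 ∈ Set.Ici (2 : ℝ) by simp only [Set.mem_Ici]; linarith) (by linarith)
  rw [Real.Gamma_two, Real.Gamma_add_one (by linarith)] at h
  rwa [inv_le_iff_one_le_mul₀' (by linarith)]

/-- Midpoint convexity at `s + 1` and `2 - s`: here `Γ(3/2) = √π / 2 ≥ 7/8` and `Γ(2 - s) ≤ 1`,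
which leaves `2 · 7/8 - 1`. -/
theorem three_quarters_le_Gamma_add_one {s : ℝ} (h0 : 0 ≤ s) (h1 : s ≤ 1) :
    3 / 4 ≤ Real.Gamma (s + 1) := by
  have h := Real.convexOn_Gamma.2 (show s + 1 ∈ Set.Ioi (0 : ℝ) by simp only [Set.mem_Ioi]; linarith)
    (show 1 - s + 1 ∈ Set.Ioi (0 : ℝ) by simp only [Set.mem_Ioi]; linarith)
    (show (0 : ℝ) ≤ 1 / 2 by norm_num) (show (0 : ℝ) ≤ 1 / 2 by norm_num) (by norm_num)
  have h2 := Gamma_add_one_le_one (sub_nonneg.2 h1) (by linarith)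
  have h3 : 7 / 4 ≤ √Real.pi := Real.le_sqrt_of_sq_le (by linarith [Real.pi_gt_d2])
  have h4 : Real.Gamma (1 / 2 + 1) = 1 / 2 * √Real.pi := by
    rw [Real.Gamma_add_one (by norm_num), Real.Gamma_one_half_eq]
  simp only [smul_eq_mul] at h
  rw [show 1 / 2 * (s + 1) + 1 / 2 * (1 - s + 1) = (1 / 2 + 1 : ℝ) by ring, h4] at h
  linarith

/-- The tangent bound `u ≤ exp (u - 1)` at `u = t / (x + 1)`, raised to the power `x`, dominates the
Gamma integrand by an exponential of rate `1 / (x + 1)`. -/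
theorem Gamma_add_one_le {x : ℝ} (hx : 0 < x) :
    Real.Gamma (x + 1) ≤ (x + 1) ^ (x + 1) * Real.exp (-x) := by
  have hx1 : 0 < x + 1 := by linarith
  have ha : -(x + 1)⁻¹ < 0 := neg_neg_of_pos (inv_pos.2 hx1)
  have hint := integral_exp_mul_Ioi ha 0
  have hI := integrableOn_exp_mul_Ioi ha 0
  rw [Real.Gamma_eq_integral hx1]
  calc ∫ t in Set.Ioi 0, Real.exp (-t) * t ^ (x + 1 - 1)
      ≤ ∫ t in Set.Ioi 0, (x + 1) ^ x * Real.exp (-x) * Real.exp (-(x + 1)⁻¹ * t) := by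
        refine setIntegral_mono_on (Real.GammaIntegral_convergent hx1) (hI.const_mul _)
          measurableSet_Ioi fun t ht => ?_
        have ht : 0 < t := ht
        rw [add_sub_cancel_right]
        have h1 : t / (x + 1) ≤ Real.exp (t / (x + 1) - 1) := by
          linarith [Real.add_one_le_exp (t / (x + 1) - 1)]
        have h2 := Real.rpow_le_rpow (by positivity) h1 hx.le
        rw [Real.div_rpow ht.le hx1.le, div_le_iff₀ (by positivity), ← Real.exp_mul] at h2
        calc Real.exp (-t) * t ^ x
            ≤ Real.exp (-t) * (Real.exp ((t / (x + 1) - 1) * x) * (x + 1) ^ x) := by gcongr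
          _ = (x + 1) ^ x * (Real.exp (-t) * Real.exp ((t / (x + 1) - 1) * x)) := by ring
          _ = (x + 1) ^ x * (Real.exp (-x) * Real.exp (-(x + 1)⁻¹ * t)) := by
              rw [← Real.exp_add, ← Real.exp_add]
              congr 2
              field_simp
              ring
          _ = _ := by ring
    _ = _ := by
        rw [integral_const_mul, hint, Real.rpow_add_one hx1.ne']
        simp
        ring

/-! ### Powers -/

theorem pow_le_exp_one_mul {n : ℕ} {y : ℝ} (hy : 0 < y) (hn : (n : ℝ) ≤ y) :
    ((y + 1) / y) ^ n ≤ Real.exp 1 := by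
  have h : (y + 1) / y ≤ Real.exp (1 / y) := by
    rw [add_div, div_self hy.ne', add_comm]
    exact Real.add_one_le_exp _
  calc ((y + 1) / y) ^ n ≤ Real.exp (1 / y) ^ n := by gcongr
    _ = Real.exp (n * (1 / y)) := (Real.exp_nat_mul _ _).symm
    _ ≤ Real.exp 1 := by
        refine Real.exp_le_exp.2 ?_
        rw [mul_one_div, div_le_one hy]; exact hn

theorem rpow_div_le_sum_rpow {p : ℝ} (hp : 0 ≤ p) (n : ℕ) :
    (n : ℝ) ^ (p + 1) / (p + 1) ≤ ∑ k ∈ Finset.range (n + 1), (k : ℝ) ^ p := by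
  have hp1 : 0 < p + 1 := by linarith
  induction n with
  | zero => simp [Real.zero_rpow hp1.ne']; positivity
  | succ n ih =>
    rw [Finset.sum_range_succ]
    have hn : (0 : ℝ) < n + 1 := by positivity
    -- Bernoulli's inequality replaces the comparison with an integral: it bounds the increment of
    -- `n ^ (p + 1)` by `(p + 1) (n + 1) ^ p`.
    have hb := one_add_mul_self_le_rpow_one_add (s := -1 / ((n : ℝ) + 1))
      (by rw [le_div_iff₀ hn]; linarith [(Nat.cast_nonneg n : (0 : ℝ) ≤ n)])
      (show 1 ≤ p + 1 by linarith)
    rw [show 1 + -1 / ((n : ℝ) + 1) = n / (n + 1) by field_simp; ring,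
      Real.div_rpow (Nat.cast_nonneg n) hn.le, le_div_iff₀ (by positivity)] at hb
    have h2 : ((n : ℝ) + 1) ^ (p + 1) = (n + 1) ^ p * (n + 1) := Real.rpow_add_one hn.ne' p
    have h3 : ((n : ℝ) + 1) ^ (p + 1) - (p + 1) * (n + 1) ^ p ≤ (n : ℝ) ^ (p + 1) := by
      refine le_trans (le_of_eq ?_) hb
      rw [h2]; field_simp; ring
    push_cast
    calc ((n : ℝ) + 1) ^ (p + 1) / (p + 1)
        ≤ ((n : ℝ) ^ (p + 1) + (p + 1) * (n + 1) ^ p) / (p + 1) := by gcongr; linarith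
      _ = (n : ℝ) ^ (p + 1) / (p + 1) + (n + 1) ^ p := by field_simp
      _ ≤ _ := by gcongr

/-- After division the claim is `(1.77 / 2) ^ d / 4 · (d / (d - 1)) ^ (d - 1) · ((d + 1) / d) ^ d ≤
1`, and each of the last two factors is at most `e`. -/
theorem pow_div_four_mul_le {d : ℕ} (hd : 2 ≤ d) :
    (1.77 : ℝ) ^ d / 4 * ((d - 1) * d ^ (d - 1)) ≤
      (d - 1) ^ d * (2 * ((1 : ℝ) / d + 1)⁻¹) ^ d := by
  -- `6` is the least `d` with `(1.77 / 2) ^ d · e ^ 2 / 4 ≤ 1`.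
  obtain hlt | hge := lt_or_ge d 6
  · interval_cases d <;> norm_num
  have hd6 : (6 : ℝ) ≤ d := by exact_mod_cast hge
  obtain ⟨n, rfl⟩ : ∃ n, d = n + 1 := ⟨d - 1, by omega⟩
  push_cast at hd6 ⊢
  set y : ℝ := (n : ℝ) with hy
  have hy5 : 5 ≤ y := by linarith
  have h1 : ((y + 1) / y) ^ n ≤ Real.exp 1 := pow_le_exp_one_mul (by linarith) le_rfl
  have h2 : ((y + 1 + 1) / (y + 1)) ^ (n + 1) ≤ Real.exp 1 :=
    pow_le_exp_one_mul (by linarith) (by push_cast; linarith)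
  have h3 : (1.77 / 2 : ℝ) ^ (n + 1) ≤ (1.77 / 2) ^ 6 :=
    pow_le_pow_of_le_one (by norm_num) (by norm_num) (by omega)
  have h4 : (1.77 / 2 : ℝ) ^ (n + 1) / 4 * (((y + 1) / y) ^ n * ((y + 1 + 1) / (y + 1)) ^ (n + 1))
      ≤ 1 := by
    calc _ ≤ (1.77 / 2 : ℝ) ^ 6 / 4 * (Real.exp 1 * Real.exp 1) := by gcongr
      _ ≤ (1.77 / 2 : ℝ) ^ 6 / 4 * (2.7182818286 * 2.7182818286) := by
          gcongr <;> exact Real.exp_one_lt_d9.le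
      _ ≤ 1 := by norm_num
  have hy0 : y ≠ 0 := by linarith
  have hy1 : y + 1 ≠ 0 := by linarith
  have hy2 : y + 1 + 1 ≠ 0 := by linarith
  have e : (y + 1 - 1) ^ (n + 1) * (2 * ((1 : ℝ) / (y + 1) + 1)⁻¹) ^ (n + 1) *
      ((1.77 / 2 : ℝ) ^ (n + 1) / 4 * (((y + 1) / y) ^ n * ((y + 1 + 1) / (y + 1)) ^ (n + 1))) =
      1.77 ^ (n + 1) / 4 * ((y + 1 - 1) * (y + 1) ^ n) := by
    rw [show (1 : ℝ) / (y + 1) + 1 = (y + 1 + 1) / (y + 1) by field_simp; ring, add_sub_cancel_right,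
      inv_div, mul_pow, div_pow, div_pow, div_pow, div_pow]
    field_simp
    ring
  rw [← e]
  refine mul_le_of_le_one_right ?_ h4
  have : 0 ≤ y + 1 - 1 := by linarith
  positivity

theorem pow_mul_le_pow_of_seventeen_le {d : ℕ} (hd : 17 ≤ d) :
    (1.2 : ℝ) ^ (d - 1) * Real.exp (49 / 16) * ((d + 1) / d) ≤ 1.5 ^ d := by
  have he : Real.exp (49 / 16) ≤ 40 := by
    have h1 : Real.exp (49 / 16) ≤ Real.exp (7 / 2) := Real.exp_le_exp.2 (by norm_num)
    refine h1.trans (abs_le_of_sq_le_sq' ?_ (by norm_num)).2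
    rw [← Real.exp_nat_mul, show ((2 : ℕ) : ℝ) * (7 / 2) = (7 : ℕ) * 1 by norm_num,
      Real.exp_nat_mul]
    calc Real.exp 1 ^ 7 ≤ 2.7182818286 ^ 7 := by gcongr; exact Real.exp_one_lt_d9.le
      _ ≤ 40 ^ 2 := by norm_num
  have hd' : (17 : ℝ) ≤ d := by exact_mod_cast hd
  have hf : ((d : ℝ) + 1) / d ≤ 18 / 17 := by
    rw [div_le_div_iff₀ (by linarith) (by norm_num)]; linarith
  calc (1.2 : ℝ) ^ (d - 1) * Real.exp (49 / 16) * ((d + 1) / d)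
      ≤ 1.2 ^ (d - 1) * 40 * (18 / 17) := by gcongr
    _ ≤ 1.5 ^ d := by
        clear hf hd'
        induction d, hd using Nat.le_induction with
        | base => norm_num
        | succ n hn ih =>
          obtain ⟨m, rfl⟩ : ∃ m, n = m + 1 := ⟨n - 1, by omega⟩
          simp only [Nat.add_sub_cancel] at ih ⊢
          rw [pow_succ _ (m + 1), pow_succ _ m]
          have : (0 : ℝ) < 1.2 ^ m := by positivity
          linarith

/-- The factors of the volume of the enclosing ball that have exponent `d / p`. -/
theorem exp_neg_le_rpow_div {d : ℕ} (hd : 17 ≤ d) {p : ℝ} (hp : 1 ≤ p) :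
    Real.exp (-(33 / 16)) ≤
      (Real.exp 1 * (((d : ℝ) - 1) / (p + 1)) / (d / p + 1)) ^ ((d : ℝ) / p) := by
  have hd' : (17 : ℝ) ≤ d := by exact_mod_cast hd
  have hp0 : 0 < p := by linarith
  have hexp (y : ℝ) (hy : 0 < y) : Real.exp (-(1 / y)) ≤ y / (y + 1) := by
    have h : (y + 1) / y ≤ Real.exp (1 / y) := by
      rw [add_div, div_self hy.ne', add_comm]
      exact Real.add_one_le_exp _
    rw [Real.exp_neg, ← inv_div (y + 1) y]
    gcongr
  set x : ℝ := d / p with hx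
  have hx0 : 0 < x := by positivity
  have h1 := hexp x hx0
  have h2 := hexp (d - 1) (by linarith)
  have h2' := (Real.exp_pos _).le.trans h2
  -- With `x = d / p` the base factors as `(e p / (p + 1)) · ((d - 1) / d) · (x / (x + 1))`. The
  -- first factor is discarded; the others cost `exp (-x / (d - 1))` and `exp (-1)` after raising to
  -- the power `x`, whence `33/16 = 17/16 + 1`.
  have h3 : 1 ≤ Real.exp 1 * p / (p + 1) := by
    rw [le_div_iff₀ (by linarith)]
    nlinarith [Real.exp_one_gt_d9]
  have hbase : Real.exp (-(1 / (d - 1)) - 1 / x) ≤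
      Real.exp 1 * (((d : ℝ) - 1) / (p + 1)) / (x + 1) := by
    calc Real.exp (-(1 / (d - 1)) - 1 / x)
        = 1 * (Real.exp (-(1 / (d - 1))) * Real.exp (-(1 / x))) := by
          rw [one_mul, ← Real.exp_add]; rfl
      _ ≤ Real.exp 1 * p / (p + 1) * ((d - 1) / (d - 1 + 1) * (x / (x + 1))) := by gcongr
      _ = _ := by
          rw [sub_add_cancel]
          have : (d : ℝ) = x * p := by rw [hx]; field_simp
          rw [show x / (x + 1) = d / p / (x + 1) from rfl]
          field_simp
  calc Real.exp (-(33 / 16)) ≤ Real.exp ((-(1 / (d - 1)) - 1 / x) * x) := by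
        refine Real.exp_le_exp.2 ?_
        have h4 : x ≤ d := div_le_self (by linarith) hp
        have h5 : x / (d - 1) ≤ 17 / 16 := by
          rw [div_le_div_iff₀ (by linarith) (by norm_num)]; linarith
        have h6 : (-(1 / ((d : ℝ) - 1)) - 1 / x) * x = -(x / (d - 1)) - 1 := by
          field_simp
        rw [h6]; linarith
    _ = Real.exp (-(1 / (d - 1)) - 1 / x) ^ x := Real.exp_mul _ _
    _ ≤ _ := Real.rpow_le_rpow (Real.exp_pos _).le hbase hx0.le

theorem pow_div_mul_le_of_seventeen_le {d : ℕ} (hd : 17 ≤ d) {p : ℝ} (hp : 1 ≤ p)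
    {r : ℝ} (hr : 0 ≤ r) (hrp : ((d : ℝ) - 1) ^ (p + 1) / (p + 1) ≤ r ^ p) :
    (1.2 : ℝ) ^ (d - 1) / d * ((d - 1) * d ^ (d - 1)) ≤
      r ^ d * ((2 * Real.Gamma (1 / p + 1)) ^ d / Real.Gamma (d / p + 1)) := by
  have hd' : (17 : ℝ) ≤ d := by exact_mod_cast hd
  have hd1 : (0 : ℝ) < d - 1 := by linarith
  have hp0 : 0 < p := by linarith
  have hkey := exp_neg_le_rpow_div hd hp
  set x : ℝ := d / p with hx
  have hx0 : 0 < x := by positivity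
  have hxd : x ≤ d := div_le_self (by linarith) hp
  have hpx : p * x = d := by rw [hx]; field_simp
  have hG1 : (1.5 : ℝ) ≤ 2 * Real.Gamma (1 / p + 1) := by
    have := three_quarters_le_Gamma_add_one (show 0 ≤ 1 / p by positivity)
      ((div_le_one hp0).2 hp)
    linarith
  have hG2 := Gamma_add_one_le hx0
  have hG0 : 0 < Real.Gamma (x + 1) := Real.Gamma_pos_of_pos (by linarith)
  have hrd : ((d : ℝ) - 1) ^ d * (((d : ℝ) - 1) / (p + 1)) ^ x ≤ r ^ d := by
    have h := Real.rpow_le_rpow (by positivity) hrp hx0.le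
    rw [← Real.rpow_mul hr, hpx, Real.rpow_natCast, Real.rpow_add_one hd1.ne', mul_div_assoc,
      Real.mul_rpow (by positivity) (by positivity), ← Real.rpow_mul hd1.le, hpx,
      Real.rpow_natCast] at h
    exact h
  have hpow : (d : ℝ) ^ (d - 1) ≤ Real.exp 1 * (d - 1) ^ (d - 1) := by
    have h := pow_le_exp_one_mul (n := d - 1) hd1 (by rw [Nat.cast_sub (by omega), Nat.cast_one])
    rwa [sub_add_cancel, div_pow, div_le_iff₀ (by positivity)] at h
  have hfin := pow_mul_le_pow_of_seventeen_le hd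
  have hpred : ((d : ℝ) - 1) * (d - 1) ^ (d - 1) = (d - 1) ^ d := by
    rw [← pow_succ', Nat.sub_add_cancel (by omega)]
  calc (1.2 : ℝ) ^ (d - 1) / d * ((d - 1) * d ^ (d - 1))
      ≤ 1.2 ^ (d - 1) / d * ((d - 1) * (Real.exp 1 * (d - 1) ^ (d - 1))) := by gcongr
    -- The exponent splits as `1 = 49/16 - 33/16`: the negative part pays for the factors of
    -- exponent `x`, and the positive part is absorbed by `(1.5 / 1.2) ^ d`.
    _ = (d - 1) ^ d * (1.2 ^ (d - 1) * Real.exp (49 / 16) * ((d + 1) / d)) *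
          (Real.exp (-(33 / 16)) / (d + 1)) := by
        rw [← hpred, show Real.exp 1 = Real.exp (49 / 16) * Real.exp (-(33 / 16)) by
          rw [← Real.exp_add]; norm_num]
        field_simp
    _ ≤ (d - 1) ^ d * 1.5 ^ d * (Real.exp (-(33 / 16)) / (d + 1)) := by gcongr
    _ ≤ (d - 1) ^ d * 1.5 ^ d *
          ((Real.exp 1 * (((d : ℝ) - 1) / (p + 1)) / (x + 1)) ^ x / (x + 1)) := by gcongr
    _ = ((d - 1) ^ d * (((d : ℝ) - 1) / (p + 1)) ^ x) *
          (1.5 ^ d / ((x + 1) ^ (x + 1) * Real.exp (-x))) := by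
        rw [Real.div_rpow (by positivity) (by positivity),
          Real.mul_rpow (by positivity) (by positivity), ← Real.exp_mul, one_mul,
          Real.rpow_add_one (by positivity), Real.exp_neg]
        field_simp
    _ ≤ r ^ d * ((2 * Real.Gamma (1 / p + 1)) ^ d / Real.Gamma (x + 1)) := by gcongr

/-! ### The lower bounds -/

theorem le_lintegral_rejectionSampleCount_voteBall {d : ℕ} (hd : 2 ≤ d) {p : ℝ≥0∞} (hp : 1 ≤ p)
    {Ω : Type*} [MeasurableSpace Ω] {μ : Measure Ω} [IsProbabilityMeasure μ]
    {X : ℕ → Ω → (Fin d → ℝ)}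
    (hunif : ∀ n, pdf.IsUniform (X n) (minEnclosingBall p (voteBall d)) μ volume)
    (hindep : iIndepFun X μ) {K V : ℝ} (hK : 0 < K)
    (hV : volume (minEnclosingBall p (voteBall d)) = ENNReal.ofReal V)
    (hKV : K * ((d - 1) * d ^ (d - 1)) ≤ V) :
    ENNReal.ofReal K ≤ ∫⁻ ω, rejectionSampleCount X (voteBall d) ω ∂μ := by
  have hd' : (2 : ℝ) ≤ d := by exact_mod_cast hd
  have hpos : (0 : ℝ) < (d - 1) * d ^ (d - 1) :=
    mul_pos (by linarith) (pow_pos (by linarith) _)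
  have hV0 : 0 < V := (mul_pos hK hpos).trans_le hKV
  refine le_lintegral_rejectionSampleCount_of_isUniform (measurableSet_voteBall d)
    (measurableSet_lpBall d p hp _) ?_ ?_ hunif hindep ?_
  · change volume (minEnclosingBall p (voteBall d)) ≠ 0
    rw [hV]; simpa using hV0
  · change volume (minEnclosingBall p (voteBall d)) ≠ ∞
    rw [hV]; exact ENNReal.ofReal_ne_top
  · calc ENNReal.ofReal K * volume (voteBall d)
        ≤ ENNReal.ofReal K * ENNReal.ofReal ((d - 1) * d ^ (d - 1)) := by
          gcongr; exact volume_voteBall_le hd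
      _ = ENNReal.ofReal (K * ((d - 1) * d ^ (d - 1))) := (ENNReal.ofReal_mul hK.le).symm
      _ ≤ ENNReal.ofReal V := ENNReal.ofReal_le_ofReal hKV
      _ = volume (minEnclosingBall p (voteBall d)) := hV.symm

theorem mainTheorem10 (d : ℕ) (hd : 2 ≤ d) (p : ℝ≥0∞) (hp : 1 ≤ p)
    {Ω : Type*} [MeasurableSpace Ω] (μ : Measure Ω) [IsProbabilityMeasure μ]
    (X : ℕ → Ω → (Fin d → ℝ))
    (hunif : ∀ n, pdf.IsUniform (X n) (minEnclosingBall p (voteBall d)) μ volume)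
    (hindep : iIndepFun X μ) :
    ((d : ℝ≥0∞) ≤ p →
      ENNReal.ofReal ((1.77 : ℝ) ^ d / 4) ≤ ∫⁻ ω, rejectionSampleCount X (voteBall d) ω ∂μ) ∧
    (p < (d : ℝ≥0∞) →
      ENNReal.ofReal ((1.2 : ℝ) ^ (d - 1) / (d : ℝ)) ≤
        ∫⁻ ω, rejectionSampleCount X (voteBall d) ω ∂μ) := by
  have hd' : (2 : ℝ) ≤ d := by exact_mod_cast hd
  have hr1 := sub_one_le_minEnclosingRadius (by omega : 1 ≤ d) p hp
  have hr0 : 0 ≤ minEnclosingRadius p (voteBall d) := by linarith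
  refine ⟨fun hdp => ?_, fun hdp => ?_⟩
  · obtain rfl | hptop := eq_or_ne p ∞
    · refine le_lintegral_rejectionSampleCount_voteBall hd hp hunif hindep (by positivity)
        (volume_lpBall_top d hr0) ((pow_div_four_mul_le hd).trans ?_)
      rw [← mul_pow]
      have h : ((1 : ℝ) / d + 1)⁻¹ ≤ 1 := inv_le_one_of_one_le₀ (by
        have : (0 : ℝ) ≤ 1 / d := by positivity
        linarith)
      have hd1 : (0 : ℝ) ≤ d - 1 := by linarith
      refine pow_le_pow_left₀ (by positivity) ?_ d
      calc ((d : ℝ) - 1) * (2 * ((1 : ℝ) / d + 1)⁻¹) ≤ ((d : ℝ) - 1) * (2 * 1) := by gcongr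
        _ ≤ _ := by linarith
    · obtain ⟨q, rfl⟩ : ∃ q : ℝ, p = ENNReal.ofReal q :=
        ⟨p.toReal, (ENNReal.ofReal_toReal hptop).symm⟩
      have hq : 1 ≤ q := by simpa using hp
      have hdq : (d : ℝ) ≤ q := by
        rw [← ENNReal.ofReal_natCast, ENNReal.ofReal_le_ofReal_iff (by linarith)] at hdp
        exact hdp
      refine le_lintegral_rejectionSampleCount_voteBall hd hp hunif hindep (by positivity)
        (volume_lpBall d (by omega) hq hr0) ((pow_div_four_mul_le hd).trans ?_)
      have h1 : Real.Gamma (d / q + 1) ≤ 1 :=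
        Gamma_add_one_le_one (by positivity) ((div_le_one (by linarith)).2 hdq)
      have h0 : 0 < Real.Gamma (d / q + 1) := Real.Gamma_pos_of_pos (by positivity)
      have h2 : ((1 : ℝ) / d + 1)⁻¹ ≤ Real.Gamma (1 / q + 1) := by
        refine le_trans ?_ (inv_add_one_le_Gamma_add_one (by positivity))
        gcongr
      have hd1 : (0 : ℝ) ≤ d - 1 := by linarith
      refine mul_le_mul (pow_le_pow_left₀ hd1 hr1 d) ?_ (by positivity) (by positivity)
      rw [le_div_iff₀ h0]
      exact (mul_le_of_le_one_right (by positivity) h1).trans (by gcongr)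
  -- For `d ≤ 16` one has `1.2 ^ (d - 1) ≤ d`, so the trivial bound `1` on the expectation suffices.
  · obtain hlt | hge := lt_or_ge d 17
    · refine le_trans ?_ (one_le_lintegral_rejectionSampleCount μ X (voteBall d))
      rw [ENNReal.ofReal_le_one]
      clear hr0 hr1 hd' hunif hindep hdp X
      interval_cases d <;> norm_num
    · have hptop : p ≠ ∞ := hdp.ne_top
      obtain ⟨q, rfl⟩ : ∃ q : ℝ, p = ENNReal.ofReal q :=
        ⟨p.toReal, (ENNReal.ofReal_toReal hptop).symm⟩
      have hq : 1 ≤ q := by simpa using hp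
      refine le_lintegral_rejectionSampleCount_voteBall hd hp hunif hindep (by positivity)
        (volume_lpBall d (by omega) hq hr0) (pow_div_mul_le_of_seventeen_le hge hq hr0 ?_)
      refine le_trans ?_ (sum_rpow_le_minEnclosingRadius_rpow d hq)
      have h := rpow_div_le_sum_rpow (by linarith : 0 ≤ q) (d - 1)
      rwa [Nat.sub_add_cancel (by omega), Nat.cast_sub (by omega), Nat.cast_one] at h
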